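/- Let $\mathcal V$ be a monoidal model category (a model category with a biclosed monoidal structure satisfying the pushout-product axiom and the unit axiom), and let $I_{\mathcal V}$ be a set of generating cofibrations of $\mathcal V$, so that the trivial fibrations of $\mathcal V$ are exactly the maps with the right lifting property with respect to $I_{\mathcal V}$. Let $\mathcal M$ be a model $\mathcal V$-category (for instance a monoidal model $\mathcal V$-category): a tensored and cotensored $\mathcal V$-category with a model structure such that the tensor $\otimes:\mathcal V\times\mathcal M\to\mathcal M$ satisfies the pushout-product axiom, and such that $Q\otimes X\to \mathbb 1\otimes X$ is a weak equivalence for every cofibrant $X$ and every weak equivalence $Q\to\mathbb 1$ with $Q$ cofibrant. A class $J$ of trivial cofibrations of a model category is called *weakly generating* if every map $f:A\to B$ with $B$ fibrant that has the right lifting property with respect to $J$ is a fibration. Let $S$ be a class of cofibrations with cofibrant domain in $\mathcal M$. An object $X$ of $\mathcal M$ is *$S$-local* if it is fibrant and $s^*:\mathbf R\mathrm{Hom}_{\mathcal V}(B,X)\to\mathbf R\mathrm{Hom}_{\mathcal V}(A,X)$ is a weak equivalence in $\mathcal V$ for every $s:A\to B$ in $S$. A map $f:A\to B$ is an *$S$-local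 equivalence* if $f^*:\mathbf R\mathrm{Hom}_{\mathcal V}(B,X)\to\mathbf R\mathrm{Hom}_{\mathcal V}(A,X)$ is a weak equivalence for every $S$-local $X$. Suppose that the $\mathcal V$-enriched left Bousfield localization $L^{\mathcal V}_S\mathcal M$ exists, i.e. that there is a model structure $L^{\mathcal V}_S\mathcal M$ on the category underlying $\mathcal M$ which makes it a model $\mathcal V$-category, whose cofibrations are those of $\mathcal M$ and whose weak equivalences are the $S$-local equivalences. If $J'$ is a set of weakly generating trivial cofibrations for $\mathcal M$, then $$J'\cup(I_{\mathcal V}\,\square\,S)$$ is a class of weakly generating trivial cofibrations for $L^{\mathcal V}_S\mathcal M$ (a set if $S$ is a set), where $I_{\mathcal V}\,\square\,S$ consists of the pushout-products $V\otimes B\sqcup_{V\otimes A}W\otimes A\to W\otimes B$ of maps $V\to W$ in $I_{\mathcal V}$ and maps $A\to B$ in $S$. -/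

import Mathlib

open CategoryTheory Limits MonoidalCategory HomotopicalAlgebra

universe v₁ v₂ v₃ u₁ u₂ u₃

namespace EnrichedBousfield

/-- The pushout-product of `f : A ⟶ B` and `g : X ⟶ Y` along a bifunctor `F`, that is, the
induced map `F B X ⨿_{F A X} F A Y ⟶ F B Y`. -/
noncomputable abbrev pushoutProduct {C₁ : Type u₁} {C₂ : Type u₂} {C₃ : Type u₃}
    [Category.{v₁} C₁] [Category.{v₂} C₂] [Category.{v₃} C₃] [HasPushouts C₃]
    (F : C₁ ⥤ C₂ ⥤ C₃) {A B : C₁} (f : A ⟶ B) {X Y : C₂} (g : X ⟶ Y) :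
    (Functor.PushoutObjObj.ofHasPushout F f g).pt ⟶ (F.obj B).obj Y :=
  (Functor.PushoutObjObj.ofHasPushout F f g).ι

/-- The pushout-product axiom for a bifunctor `F` from a model category `C₁` and a model
category `C₂` to `C₂` (the case of a category acting on another one). -/
structure PushoutProductAxiom {C₁ : Type u₁} {C₂ : Type u₂}
    [Category.{v₁} C₁] [Category.{v₂} C₂] [ModelCategory C₁] [ModelCategory C₂]
    (F : C₁ ⥤ C₂ ⥤ C₂) : Prop where
  cofibration : ∀ {A B : C₁} (f : A ⟶ B) {X Y : C₂} (g : X ⟶ Y),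
    Cofibration f → Cofibration g → Cofibration (pushoutProduct F f g)
  weakEquivalence_left : ∀ {A B : C₁} (f : A ⟶ B) {X Y : C₂} (g : X ⟶ Y),
    Cofibration f → WeakEquivalence f → Cofibration g →
      WeakEquivalence (pushoutProduct F f g)
  weakEquivalence_right : ∀ {A B : C₁} (f : A ⟶ B) {X Y : C₂} (g : X ⟶ Y),
    Cofibration f → Cofibration g → WeakEquivalence g →
      WeakEquivalence (pushoutProduct F f g)

/-- A monoidal model category: a model category with a (bi)closed monoidal structure
satisfying the pushout-product axiom and the unit axiom. -/
class MonoidalModelCategory (V : Type u₁) [Category.{v₁} V] [ModelCategory V]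
    [MonoidalCategory V] : Prop where
  isLeftAdjoint_tensorLeft : ∀ A : V, (tensorLeft A).IsLeftAdjoint
  isLeftAdjoint_tensorRight : ∀ A : V, (tensorRight A).IsLeftAdjoint
  pushoutProduct : PushoutProductAxiom (curriedTensor V)
  unit_left : ∀ {Q : V} (q : Q ⟶ 𝟙_ V) (X : V), IsCofibrant Q → WeakEquivalence q →
    IsCofibrant X → WeakEquivalence (q ▷ X)
  unit_right : ∀ {Q : V} (q : Q ⟶ 𝟙_ V) (X : V), IsCofibrant Q → WeakEquivalence q →
    IsCofibrant X → WeakEquivalence (X ◁ q)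

/-- A closed `V`-module structure on `M`, i.e. `M` is a tensored and cotensored `V`-category:
the tensor is the given action `V × M ⟶ M`, which is part of an adjunction of two variables
together with the `V`-valued hom-objects `hom` and the cotensor. -/
class ClosedModule (V : Type u₁) [Category.{v₁} V] [MonoidalCategory V]
    (M : Type u₂) [Category.{v₂} M] [MonoidalLeftAction V M] where
  /-- the hom-objects `Hom_V(A, X)` -/
  hom : Mᵒᵖ ⥤ M ⥤ V
  /-- `M(T ⊗ A, X) ≃ V(T, Hom_V(A, X))` -/
  homAdj : (MonoidalLeftAction.curriedAction V M).flip ⊣₂ hom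
  /-- the cotensors `X ^ T` -/
  cotensor : Vᵒᵖ ⥤ M ⥤ M
  /-- `M(T ⊗ A, X) ≃ M(A, X ^ T)` -/
  cotensorAdj : MonoidalLeftAction.curriedAction V M ⊣₂ cotensor

section

variable (V : Type u₁) [Category.{v₁} V] [ModelCategory V] [MonoidalCategory V]
  {M : Type u₂} [Category.{v₂} M] [MonoidalLeftAction V M]

/-- The model structure `str` makes the tensored and cotensored `V`-category `M` into a
model `V`-category: the pushout-product axiom and the unit axiom hold. -/
structure IsModelVCategory (str : ModelCategory M) : Prop where
  pushoutProduct : PushoutProductAxiom (MonoidalLeftAction.curriedAction V M)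
  unit : ∀ {Q : V} (q : Q ⟶ 𝟙_ V) (X : M), IsCofibrant Q → WeakEquivalence q →
    IsCofibrant X →
      WeakEquivalence (((MonoidalLeftAction.curriedAction V M).map q).app X)

variable [ClosedModule V M]

/-- For `X` fibrant (the only case in which it is used) this says that the map of derived
hom-objects `f^* : RHom_V(B, X) ⟶ RHom_V(A, X)` is a weak equivalence in `V`: it is
represented by `f'^* : Hom_V(B', X) ⟶ Hom_V(A', X)`, where `f' : A' ⟶ B'` is a cofibrant
approximation of `f`. Whether this map is a weak equivalence does not depend on the choice
of the approximation. -/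
def DerivedPrecompIsWeakEquivalence (str : ModelCategory M) {A B : M} (f : A ⟶ B) (X : M) :
    Prop :=
  ∃ (A' B' : M) (f' : A' ⟶ B') (a : A' ⟶ A) (b : B' ⟶ B),
    IsCofibrant A' ∧ IsCofibrant B' ∧ WeakEquivalence a ∧ WeakEquivalence b ∧
      f' ≫ b = a ≫ f ∧
      WeakEquivalence (((ClosedModule.hom (V := V) (M := M)).map f'.op).app X)

/-- `X` is `V`-enriched `S`-local. -/
structure IsLocal (str : ModelCategory M) (S : MorphismProperty M) (X : M) : Prop where
  isFibrant : IsFibrant X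
  weakEquivalence : ∀ {A B : M} (s : A ⟶ B), S s → DerivedPrecompIsWeakEquivalence V str s X

/-- `f` is a `V`-enriched `S`-local equivalence. -/
def IsLocalEquivalence (str : ModelCategory M) (S : MorphismProperty M) {A B : M}
    (f : A ⟶ B) : Prop :=
  ∀ X : M, IsLocal V str S X → DerivedPrecompIsWeakEquivalence V str f X

/-- The model structure `L` on the category underlying `M` is the `V`-enriched left Bousfield
localization of the model structure `str` at `S`: it makes `M` a model `V`-category, it has
the same cofibrations as `str`, and its weak equivalences are the `V`-enriched `S`-local
equivalences. -/
structure IsEnrichedBousfieldLocalization (str : ModelCategory M) (S : MorphismProperty M)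
    (L : ModelCategory M) : Prop where
  isModelVCategory : IsModelVCategory V L
  cofibrations_iff : ∀ {A B : M} (f : A ⟶ B),
    @cofibrations M _ L.categoryWithCofibrations _ _ f ↔
      @cofibrations M _ str.categoryWithCofibrations _ _ f
  weakEquivalences_iff : ∀ {A B : M} (f : A ⟶ B),
    @weakEquivalences M _ L.categoryWithWeakEquivalences _ _ f ↔
      IsLocalEquivalence V str S f

end

/-- `I` is a class of generating cofibrations: the trivial fibrations are the maps with the
right lifting property with respect to `I`. -/
def IsGeneratingCofibrations {V : Type u₁} [Category.{v₁} V] [ModelCategory V]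
    (I : MorphismProperty V) : Prop :=
  I.rlp = trivialFibrations V

/-- `J` is a class of weakly generating trivial cofibrations for the model structure `str`. -/
structure IsWeaklyGenerating {M : Type u₂} [Category.{v₂} M] (str : ModelCategory M)
    (J : MorphismProperty M) : Prop where
  le_trivialCofibrations : J ≤ trivialCofibrations M
  fibration : ∀ {A B : M} (f : A ⟶ B), J.rlp f → IsFibrant B → Fibration f

/-- The class `I □ S` of all pushout-products `i □ s` with `i ∈ I` and `s ∈ S`. -/
inductive pushoutProducts {V : Type u₁} [Category.{v₁} V] [MonoidalCategory V]
    {M : Type u₂} [Category.{v₂} M] [MonoidalLeftAction V M] [HasPushouts M]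
    (I : MorphismProperty V) (S : MorphismProperty M) : MorphismProperty M
  | mk {A B : V} (i : A ⟶ B) {X Y : M} (s : X ⟶ Y) (hi : I i) (hs : S s) :
      pushoutProducts I S (pushoutProduct (MonoidalLeftAction.curriedAction V M) i s)

end EnrichedBousfield

namespace EnrichedBousfield

/-! ### Homotopy categories and cofibrant approximations in a model category. -/

section ModelCategoryLemmas

variable {M : Type u₂} [Category.{v₂} M] [ModelCategory M]

/-! Maps in `S` are tautologically local equivalences, so they are trivial cofibrations of `L`, and
the pushout-product axiom in `L` handles `I □ S`; trivial cofibrations of `str` remain trivial in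
`L`.

Conversely, let `f : A ⟶ B` lift against `J' ⊔ I □ S` with `B` fibrant in `L`. Then `B` is fibrant
in `str`, so `f` is a fibration there. By adjunction, lifting against `I □ S` says that `Hom(Y, A) ⟶
Hom(X, A) ×_{Hom(X, B)} Hom(Y, B)` is a trivial fibration for each `s : X ⟶ Y` in `S`. Since `s^*`
is a trivial fibration on `B`, it is a weak equivalence on `A`, and `A` is local
(`weakEquivalence_hom_map_of_rlp`).

Finally, factor `f` in `L` as a trivial cofibration `i` and a fibration `p`. The middle object is
local, so `i` is a weak equivalence of `str` by the Whitehead theorem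
(`weakEquivalence_of_isLocalEquivalence`). Hence `i` lifts against `f`, and `f` is a retract of `p`
(`fibration_of_isLocal`). -/

lemma fibration_iff_rlp {X Y : M} (f : X ⟶ Y) :
    Fibration f ↔ (trivialCofibrations M).rlp f := by
  rw [trivialCofibrations_rlp, fibration_iff]

lemma isFibrant_of_fibration_of_isFibrant {X Y : M} (p : X ⟶ Y) (hp : Fibration p)
    (hY : IsFibrant Y) : IsFibrant X :=
  isFibrant_of_fibration p

/-- A cofibration between bifibrant objects which becomes invertible in the homotopy category is
a weak equivalence. -/
lemma weakEquivalence_of_isIso_map_of_cofibration {H : Type*} [Category* H] (L : M ⥤ H)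
    [L.IsLocalization (weakEquivalences M)] {X Y : M} [IsCofibrant X] [IsCofibrant Y]
    [IsFibrant X] [IsFibrant Y] (f : X ⟶ Y) [Cofibration f] [IsIso (L.map f)] :
    WeakEquivalence f := by
  obtain ⟨g, hg⟩ := map_surjective_of_isLocalization L Y X (inv (L.map f))
  obtain ⟨P, _, ⟨h⟩⟩ := ((RightHomotopyRel.iff_map_eq L (f := f ≫ g) (g := 𝟙 X)).2
    (by simp [hg])).exists_good_pathObject
  -- Homotopy extension along `f` replaces `g` by a homotopic strict retraction `r`; then `f` is a
  -- retract of `r ≫ f`, which is homotopic to the identity.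
  have sq : CommSq h.h f P.p₀ g := ⟨by simp⟩
  let r : Y ⟶ X := sq.lift ≫ P.p₁
  have hr : f ≫ r = 𝟙 X := by simp [r]
  have hr' : L.map r = inv (L.map f) := by
    rw [← cancel_epi (L.map f), ← L.map_comp, hr, L.map_id, IsIso.hom_inv_id]
  obtain ⟨P', ⟨h'⟩⟩ := (LeftHomotopyRel.iff_map_eq L (f := r ≫ f) (g := 𝟙 Y)).2
    (by simp [hr'])
  have : WeakEquivalence (r ≫ f) := h'.weakEquivalence_iff.2 inferInstance
  have ret : RetractArrow f (r ≫ f) :=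
    { i := Arrow.homMk f (𝟙 Y) (by simp [reassoc_of% hr])
      r := Arrow.homMk r (𝟙 Y) (by simp)
      retract := by ext <;> simp [hr] }
  rw [weakEquivalence_iff] at this ⊢
  exact MorphismProperty.of_retract ret this

lemma exists_cofibrant_approximation {A B : M} (f : A ⟶ B) :
    ∃ (A' B' : M) (f' : A' ⟶ B') (a : A' ⟶ A) (b : B' ⟶ B),
      IsCofibrant A' ∧ IsCofibrant B' ∧ Cofibration f' ∧ Fibration a ∧ WeakEquivalence a ∧
        Fibration b ∧ WeakEquivalence b ∧ f' ≫ b = a ≫ f := by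
  obtain ⟨A', _, a, _, _⟩ := CofibrantObject.HoCat.exists_resolution A
  let h := MorphismProperty.factorizationData (cofibrations M) (trivialFibrations M) (a ≫ f)
  exact ⟨A', h.Z, h.i, a, h.p, inferInstance, isCofibrant_of_cofibration h.i, inferInstance,
    inferInstance, inferInstance, inferInstance, inferInstance, h.fac⟩

/-- Two cofibrant approximations of a morphism are connected by trivial cofibrations to
a third one. -/
lemma exists_common_approximation {A B A₁ B₁ A₂ B₂ : M} (f : A ⟶ B)
    (f₁ : A₁ ⟶ B₁) (a₁ : A₁ ⟶ A) (b₁ : B₁ ⟶ B) (f₂ : A₂ ⟶ B₂) (a₂ : A₂ ⟶ A) (b₂ : B₂ ⟶ B)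
    [IsCofibrant A₁] [IsCofibrant B₁] [IsCofibrant A₂] [IsCofibrant B₂]
    [WeakEquivalence a₁] [WeakEquivalence b₁] [WeakEquivalence a₂] [WeakEquivalence b₂]
    (w₁ : f₁ ≫ b₁ = a₁ ≫ f) (w₂ : f₂ ≫ b₂ = a₂ ≫ f) :
    ∃ (A₃ B₃ : M) (f₃ : A₃ ⟶ B₃) (i₁ : A₁ ⟶ A₃) (i₂ : A₂ ⟶ A₃) (j₁ : B₁ ⟶ B₃) (j₂ : B₂ ⟶ B₃),
      Cofibration i₁ ∧ WeakEquivalence i₁ ∧ Cofibration i₂ ∧ WeakEquivalence i₂ ∧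
      Cofibration j₁ ∧ WeakEquivalence j₁ ∧ Cofibration j₂ ∧ WeakEquivalence j₂ ∧
      i₁ ≫ f₃ = f₁ ≫ j₁ ∧ i₂ ≫ f₃ = f₂ ≫ j₂ := by
  -- Cofibrancy of both summands makes the coproduct inclusions cofibrations, so both approximations
  -- embed in the factorization.
  let hA := MorphismProperty.factorizationData (cofibrations M) (trivialFibrations M)
    (coprod.desc a₁ a₂)
  let hB := MorphismProperty.factorizationData (cofibrations M) (trivialFibrations M)
    (coprod.desc b₁ b₂)
  have sq : CommSq (coprod.map f₁ f₂ ≫ hB.i) hA.i hB.p (hA.p ≫ f) := ⟨by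
    ext <;> simp [w₁, w₂]⟩
  have e₁ : (coprod.inl ≫ hA.i) ≫ hA.p = a₁ := by
    rw [Category.assoc, hA.fac, coprod.inl_desc]
  have e₂ : (coprod.inr ≫ hA.i) ≫ hA.p = a₂ := by
    rw [Category.assoc, hA.fac, coprod.inr_desc]
  have e₃ : (coprod.inl ≫ hB.i) ≫ hB.p = b₁ := by
    rw [Category.assoc, hB.fac, coprod.inl_desc]
  have e₄ : (coprod.inr ≫ hB.i) ≫ hB.p = b₂ := by
    rw [Category.assoc, hB.fac, coprod.inr_desc]
  exact ⟨hA.Z, hB.Z, sq.lift, coprod.inl ≫ hA.i, coprod.inr ≫ hA.i, coprod.inl ≫ hB.i,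
    coprod.inr ≫ hB.i, inferInstance, weakEquivalence_of_postcomp_of_fac e₁, inferInstance,
    weakEquivalence_of_postcomp_of_fac e₂, inferInstance, weakEquivalence_of_postcomp_of_fac e₃,
    inferInstance, weakEquivalence_of_postcomp_of_fac e₄, by simp, by simp⟩

end ModelCategoryLemmas

/-! ### Lifting properties and hom-objects. -/

section

variable {V : Type u₁} [Category.{v₁} V] [MonoidalCategory V]
  {M : Type u₂} [Category.{v₂} M] [MonoidalLeftAction V M] [ClosedModule V M]

lemma isLeftAdjoint_curriedAction_obj (T : V) :
    ((MonoidalLeftAction.curriedAction V M).obj T).IsLeftAdjoint :=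
  (ClosedModule.cotensorAdj.adj T).isLeftAdjoint

lemma isRightAdjoint_hom_obj (A : M) :
    ((ClosedModule.hom (V := V)).obj (.op A)).IsRightAdjoint :=
  (ClosedModule.homAdj.adj A).isRightAdjoint

lemma hasLiftingProperty_pullbackObjObj_iff [HasPushouts M] {T T' : V} (k : T ⟶ T')
    {A B : M} {s : A ⟶ B} {X Y : M} {p : X ⟶ Y} (sq : (ClosedModule.hom (V := V)).PullbackObjObj s p) :
    HasLiftingProperty k sq.π ↔
      HasLiftingProperty (pushoutProduct (MonoidalLeftAction.curriedAction V M) k s) p :=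
  (ClosedModule.homAdj.hasLiftingProperty_iff
    (Functor.PushoutObjObj.ofHasPushout (MonoidalLeftAction.curriedAction V M) k s).flip sq).symm

end

section

variable {V : Type u₁} [Category.{v₁} V] [ModelCategory V] [MonoidalCategory V]
  {M : Type u₂} [Category.{v₂} M] [ModelCategory M] [MonoidalLeftAction V M]

/-- Different choices of pushout give isomorphic arrows. This allows the degenerate square with `g`
starting at the initial object. -/
lemma PushoutProductAxiom.weakEquivalence_ι
    (hpp : PushoutProductAxiom (MonoidalLeftAction.curriedAction V M))
    {A B : V} {f : A ⟶ B} {X Y : M} {g : X ⟶ Y}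
    (sq : (MonoidalLeftAction.curriedAction V M).PushoutObjObj f g)
    [Cofibration f] [WeakEquivalence f] [Cofibration g] : WeakEquivalence sq.ι := by
  have h := hpp.weakEquivalence_left f g inferInstance inferInstance inferInstance
  rw [weakEquivalence_iff] at h ⊢
  exact ((weakEquivalences M).arrow_mk_iso_iff
    (Functor.PushoutObjObj.ι_iso_of_iso_left (f₁ := Arrow.mk f) (f₁' := Arrow.mk f)
      (f₂ := Arrow.mk g) sq (.ofHasPushout _ f g) (Iso.refl _))).2 h

variable [ClosedModule V M]

/-- Tensoring a trivial cofibration with a cofibrant object gives a weak equivalence. -/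
lemma weakEquivalence_action_of_isCofibrant
    (hpp : PushoutProductAxiom (MonoidalLeftAction.curriedAction V M))
    {T T' : V} (k : T ⟶ T') [Cofibration k] [WeakEquivalence k] (X : M) [IsCofibrant X] :
    WeakEquivalence (((MonoidalLeftAction.curriedAction V M).map k).app X) := by
  have (T : V) := isLeftAdjoint_curriedAction_obj (M := M) T
  exact hpp.weakEquivalence_ι
    (Functor.PushoutObjObj.ofIsInitialRight _ k (initial.to X) initialIsInitial)

variable (hpp : PushoutProductAxiom (MonoidalLeftAction.curriedAction V M))
include hpp

lemma fibration_pullbackObjObj {A B : M} {s : A ⟶ B} {X Y : M} {p : X ⟶ Y}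
    (sq : (ClosedModule.hom (V := V)).PullbackObjObj s p) [Cofibration s] [Fibration p] :
    Fibration sq.π := by
  rw [fibration_iff_rlp]
  intro T T' k hk
  obtain ⟨_, _⟩ := (mem_trivialCofibrations_iff k).1 hk
  rw [hasLiftingProperty_pullbackObjObj_iff]
  have := hpp.cofibration k s inferInstance inferInstance
  have := hpp.weakEquivalence_left k s inferInstance inferInstance inferInstance
  infer_instance

lemma weakEquivalence_pullbackObjObj {A B : M} {s : A ⟶ B} {X Y : M} {p : X ⟶ Y}
    (sq : (ClosedModule.hom (V := V)).PullbackObjObj s p) [Cofibration s] [WeakEquivalence s]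
    [Fibration p] :
    WeakEquivalence sq.π := by
  suffices trivialFibrations V sq.π from ((mem_trivialFibrations_iff _).1 this).2
  rw [← cofibrations_rlp]
  intro T T' k hk
  have : Cofibration k := ⟨hk⟩
  rw [hasLiftingProperty_pullbackObjObj_iff]
  have := hpp.cofibration k s inferInstance inferInstance
  have := hpp.weakEquivalence_right k s inferInstance inferInstance inferInstance
  infer_instance

lemma fibration_hom_map {A B : M} (s : A ⟶ B) [Cofibration s] (X : M) [IsFibrant X] :
    Fibration (((ClosedModule.hom (V := V)).map s.op).app X) := by
  have (A : M) := isRightAdjoint_hom_obj (V := V) A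
  exact fibration_pullbackObjObj hpp
    (Functor.PullbackObjObj.ofIsTerminal _ s (terminal.from X) terminalIsTerminal)

lemma weakEquivalence_hom_map {A B : M} (s : A ⟶ B) [Cofibration s] [WeakEquivalence s]
    (X : M) [IsFibrant X] :
    WeakEquivalence (((ClosedModule.hom (V := V)).map s.op).app X) := by
  have (A : M) := isRightAdjoint_hom_obj (V := V) A
  exact weakEquivalence_pullbackObjObj hpp
    (Functor.PullbackObjObj.ofIsTerminal _ s (terminal.from X) terminalIsTerminal)

/-- For a morphism `i` from `f₁` to `f₃` consisting of trivial cofibrations, precomposition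
with `f₁` is a weak equivalence on hom-objects iff precomposition with `f₃` is. -/
lemma weakEquivalence_hom_map_iff_of_trivialCofibrations {A₁ B₁ A₃ B₃ : M}
    {f₁ : A₁ ⟶ B₁} {f₃ : A₃ ⟶ B₃} {i : A₁ ⟶ A₃} {j : B₁ ⟶ B₃} [Cofibration i] [WeakEquivalence i]
    [Cofibration j] [WeakEquivalence j] (w : i ≫ f₃ = f₁ ≫ j) (X : M) [IsFibrant X] :
    WeakEquivalence (((ClosedModule.hom (V := V)).map f₁.op).app X) ↔
      WeakEquivalence (((ClosedModule.hom (V := V)).map f₃.op).app X) := by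
  have := weakEquivalence_hom_map hpp i X
  have := weakEquivalence_hom_map hpp j X
  have e : ((ClosedModule.hom (V := V)).map f₃.op).app X ≫ (ClosedModule.hom.map i.op).app X =
      (ClosedModule.hom.map j.op).app X ≫ (ClosedModule.hom.map f₁.op).app X := by
    rw [← NatTrans.comp_app, ← NatTrans.comp_app, ← Functor.map_comp, ← Functor.map_comp,
      ← op_comp, ← op_comp, w]
  rw [← weakEquivalence_precomp_iff ((ClosedModule.hom.map j.op).app X), ← e,
    weakEquivalence_postcomp_iff]

/-- The map on derived hom-objects can be computed with any cofibrant approximation. -/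
lemma derivedPrecompIsWeakEquivalence_iff {A B A₁ B₁ : M} {f : A ⟶ B}
    {f₁ : A₁ ⟶ B₁} {a₁ : A₁ ⟶ A} {b₁ : B₁ ⟶ B} [IsCofibrant A₁] [IsCofibrant B₁]
    [WeakEquivalence a₁] [WeakEquivalence b₁] (w₁ : f₁ ≫ b₁ = a₁ ≫ f) (X : M) [IsFibrant X] :
    DerivedPrecompIsWeakEquivalence V inferInstance f X ↔
      WeakEquivalence (((ClosedModule.hom (V := V)).map f₁.op).app X) := by
  refine ⟨?_, fun h ↦ ⟨A₁, B₁, f₁, a₁, b₁, inferInstance, inferInstance, inferInstance,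
    inferInstance, w₁, h⟩⟩
  rintro ⟨A₂, B₂, f₂, a₂, b₂, _, _, _, _, w₂, h⟩
  obtain ⟨A₃, B₃, f₃, i₁, i₂, j₁, j₂, _, _, _, _, _, _, _, _, e₁, e₂⟩ :=
    exists_common_approximation f f₁ a₁ b₁ f₂ a₂ b₂ w₁ w₂
  rwa [weakEquivalence_hom_map_iff_of_trivialCofibrations hpp e₁ X,
    ← weakEquivalence_hom_map_iff_of_trivialCofibrations hpp e₂ X]

lemma derivedPrecompIsWeakEquivalence_iff_of_isCofibrant {A B : M} (f : A ⟶ B)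
    [IsCofibrant A] [IsCofibrant B] (X : M) [IsFibrant X] :
    DerivedPrecompIsWeakEquivalence V inferInstance f X ↔
      WeakEquivalence (((ClosedModule.hom (V := V)).map f.op).app X) :=
  derivedPrecompIsWeakEquivalence_iff hpp (a₁ := 𝟙 A) (b₁ := 𝟙 B) (by simp) X

/-- A cofibrant approximation of `f` can be chosen to be a trivial cofibration, which induces weak
equivalences on hom-objects into fibrant objects. -/
lemma isLocalEquivalence_of_weakEquivalence (S : MorphismProperty M) {A B : M} (f : A ⟶ B)
    [WeakEquivalence f] : IsLocalEquivalence V inferInstance S f := by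
  intro X hX
  have := hX.isFibrant
  obtain ⟨A', B', f', a, b, _, _, _, _, _, _, _, w⟩ := exists_cofibrant_approximation f
  have : WeakEquivalence (f' ≫ b) := by rw [w]; infer_instance
  have := weakEquivalence_of_postcomp f' b
  exact (derivedPrecompIsWeakEquivalence_iff hpp w X).2 (weakEquivalence_hom_map hpp f' X)

end

lemma IsGeneratingCofibrations.le_cofibrations {V : Type u₁} [Category.{v₁} V] [ModelCategory V]
    {I : MorphismProperty V}
    (hI : IsGeneratingCofibrations I) : I ≤ cofibrations V := by
  rw [← trivialFibrations_llp, ← hI]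
  exact I.le_llp_rlp

/-! ### Local objects and the localized model structure. -/

section

variable {V : Type u₁} [Category.{v₁} V] [ModelCategory V] [MonoidalCategory V]
  {M : Type u₂} [Category.{v₂} M] [MonoidalLeftAction V M] [ClosedModule V M]

/-- The Whitehead theorem for local objects: local equivalences between local objects are weak
equivalences. -/
lemma weakEquivalence_of_isLocalEquivalence [ModelCategory M]
    (hM : IsModelVCategory V (inferInstance : ModelCategory M)) {S : MorphismProperty M}
    {A C : M} (hA : IsLocal V inferInstance S A) (hC : IsLocal V inferInstance S C) (i : A ⟶ C)
    (hi : IsLocalEquivalence V inferInstance S i) : WeakEquivalence i := by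
  have := hA.isFibrant
  have := hC.isFibrant
  obtain ⟨A', C', f, a, b, _, _, _, _, _, _, _, w⟩ := exists_cofibrant_approximation i
  have : IsFibrant A' := isFibrant_of_fibration a
  have : IsFibrant C' := isFibrant_of_fibration b
  have hom_we (X : M) (hX : IsLocal V inferInstance S X) :
      WeakEquivalence (((ClosedModule.hom (V := V)).map f.op).app X) := by
    have := hX.isFibrant
    exact (derivedPrecompIsWeakEquivalence_iff hM.pushoutProduct w X).1 (hi X hX)
  have := hom_we A hA
  have := hom_we C hC
  have := fibration_hom_map hM.pushoutProduct f A
  have := fibration_hom_map hM.pushoutProduct f C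
  -- The unit need not be cofibrant, so maps are lifted from `Q`; the unit axiom makes `Q ⊗ A'` and
  -- `Q ⊗ C'` weakly equivalent to `A` and `C`.
  obtain ⟨Q, _, q, _, _⟩ := CofibrantObject.HoCat.exists_resolution (𝟙_ V)
  let F := MonoidalLeftAction.curriedAction V M
  let adj : F.flip ⊣₂ ClosedModule.hom := ClosedModule.homAdj
  have := hM.unit q A' inferInstance inferInstance inferInstance
  have := hM.unit q C' inferInstance inferInstance inferInstance
  let u : (F.obj Q).obj A' ⟶ A :=
    (F.map q).app A' ≫ (MonoidalLeftAction.actionUnitNatIso V M).hom.app A' ≫ a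
  let v : (F.obj Q).obj C' ⟶ C :=
    (F.map q).app C' ≫ (MonoidalLeftAction.actionUnitNatIso V M).hom.app C' ≫ b
  have hu : WeakEquivalence u := by dsimp only [u, F]; infer_instance
  have hv : WeakEquivalence v := by dsimp only [v, F]; infer_instance
  have huv : (F.obj Q).map f ≫ v = u ≫ i := by
    have := (MonoidalLeftAction.actionUnitNatIso V M).hom.naturality_assoc f b
    dsimp only [u, v, F] at this ⊢
    rw [NatTrans.naturality_assoc, this, Functor.id_map, w]
    simp only [Category.assoc]
  -- extend `u` along `Q ⊗ f`
  have sq : CommSq (initial.to _) (initial.to Q)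
      (((ClosedModule.hom (V := V)).map f.op).app A) (adj.homEquiv (X₁ := A') u) := ⟨by simp⟩
  let r : (F.obj Q).obj C' ⟶ A := adj.homEquiv.symm sq.lift
  have hr : (F.obj Q).map f ≫ r = u := by
    have := adj.homEquiv_symm_naturality_one f sq.lift
    rw [sq.fac_right, Equiv.symm_apply_apply] at this
    exact this.symm
  -- the two maps `r ≫ i` and `v` are homotopic
  obtain ⟨P, _⟩ := Cylinder.exists_very_good Q
  have sq' : CommSq (coprod.desc (adj.homEquiv (X₁ := C') (r ≫ i)) (adj.homEquiv (X₁ := C') v)) P.i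
      (((ClosedModule.hom (V := V)).map f.op).app C)
      (P.π ≫ adj.homEquiv (X₁ := A') (u ≫ i)) := ⟨by
    have e₁ := adj.homEquiv_naturality_one f (X₂ := Q) (r ≫ i)
    have e₂ := adj.homEquiv_naturality_one f (X₂ := Q) v
    have e₃ : (F.flip.map f).app Q ≫ r ≫ i = u ≫ i := by
      rw [← hr, Category.assoc]; rfl
    have e₄ : (F.flip.map f).app Q ≫ v = u ≫ i := huv
    rw [e₃] at e₁
    rw [e₄] at e₂
    ext
    · rw [coprod.inl_desc_assoc, P.inl_i_assoc, P.i₀_π_assoc, e₁]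
    · rw [coprod.inr_desc_assoc, P.inr_i_assoc, P.i₁_π_assoc, e₂]⟩
  let h : (F.obj P.I).obj C' ⟶ C := adj.homEquiv.symm sq'.lift
  have h₀ : (F.map P.i₀).app C' ≫ h = r ≫ i := by
    have := adj.homEquiv_symm_naturality_two P.i₀ sq'.lift
    rw [← P.inl_i, Category.assoc, sq'.fac_left, coprod.inl_desc, Equiv.symm_apply_apply,
      P.inl_i] at this
    exact this.symm
  have h₁ : (F.map P.i₁).app C' ≫ h = v := by
    have := adj.homEquiv_symm_naturality_two P.i₁ sq'.lift
    rw [← P.inr_i, Category.assoc, sq'.fac_left, coprod.inr_desc, Equiv.symm_apply_apply,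
      P.inr_i] at this
    exact this.symm
  have s₀ : (F.map P.i₀).app C' ≫ (F.map P.π).app C' = 𝟙 _ := by
    rw [← NatTrans.comp_app, ← F.map_comp, P.i₀_π, F.map_id, NatTrans.id_app]
  have s₁ : (F.map P.i₁).app C' ≫ (F.map P.π).app C' = 𝟙 _ := by
    rw [← NatTrans.comp_app, ← F.map_comp, P.i₁_π, F.map_id, NatTrans.id_app]
  have : WeakEquivalence ((F.map P.i₀).app C') :=
    weakEquivalence_action_of_isCofibrant hM.pushoutProduct P.i₀ C'
  have hπ : WeakEquivalence ((F.map P.π).app C') := weakEquivalence_of_precomp_of_fac s₀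
  let L := (weakEquivalences M).Q
  have inv {X Y : M} (g : X ⟶ Y) (hg : WeakEquivalence g) : IsIso (L.map g) :=
    Localization.inverts L (weakEquivalences M) g hg.mem
  have := inv _ hu
  have := inv _ hv
  have := inv _ hπ
  have := inv a inferInstance
  have := inv b inferInstance
  have e : L.map ((F.map P.i₀).app C') = L.map ((F.map P.i₁).app C') := by
    rw [← cancel_mono (L.map ((F.map P.π).app C')), ← L.map_comp, ← L.map_comp, s₀, s₁]
  have hri : L.map r ≫ L.map i = L.map v := by
    rw [← L.map_comp, ← h₀, ← h₁, L.map_comp, L.map_comp, e]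
  have hgr : L.map ((F.obj Q).map f) ≫ L.map r = L.map u := by rw [← L.map_comp, hr]
  -- Two-out-of-six in the homotopy category: `Q ⊗ f`, `r`, `i` have invertible consecutive
  -- composites, so `r` and then `i` are invertible.
  have : IsIso (L.map r ≫ L.map i) := by rw [hri]; infer_instance
  have : Mono (L.map r) := mono_of_mono (L.map r) (L.map i)
  have : IsSplitEpi (L.map r) :=
    ⟨⟨{ section_ := CategoryTheory.inv (L.map u) ≫ L.map ((F.obj Q).map f)
        id := by rw [Category.assoc, hgr, IsIso.inv_hom_id] }⟩⟩
  have : IsIso (L.map r) := isIso_of_mono_of_isSplitEpi _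
  have : IsIso (L.map i) := IsIso.of_isIso_comp_left (L.map r) (L.map i)
  have : IsIso (L.map f ≫ L.map b) := by
    rw [← L.map_comp, w, L.map_comp]; infer_instance
  have : IsIso (L.map f) := IsIso.of_isIso_comp_right (L.map f) (L.map b)
  have := weakEquivalence_of_isIso_map_of_cofibration L f
  exact weakEquivalence_of_precomp_of_fac w.symm

lemma isLocal_of_weakEquivalence_hom_map [ModelCategory M]
    (hpp : PushoutProductAxiom (MonoidalLeftAction.curriedAction V M)) {S : MorphismProperty M}
    (hS : ∀ {A B : M} (s : A ⟶ B), S s → Cofibration s ∧ IsCofibrant A) (X : M) [IsFibrant X]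
    (h : ∀ {A B : M} (s : A ⟶ B), S s →
      WeakEquivalence (((ClosedModule.hom (V := V)).map s.op).app X)) :
    IsLocal V inferInstance S X where
  isFibrant := inferInstance
  weakEquivalence {A B} s hs := by
    obtain ⟨_, _⟩ := hS s hs
    have := isCofibrant_of_cofibration s
    exact (derivedPrecompIsWeakEquivalence_iff_of_isCofibrant hpp s X).2 (h s hs)

namespace IsEnrichedBousfieldLocalization

variable {str L : ModelCategory M} {S : MorphismProperty M}
  (hL : IsEnrichedBousfieldLocalization V str S L)
include hL

lemma trivialCofibrations_le (hM : IsModelVCategory V str) :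
    @trivialCofibrations M _ str.categoryWithCofibrations str.categoryWithWeakEquivalences ≤
      @trivialCofibrations M _ L.categoryWithCofibrations L.categoryWithWeakEquivalences :=
  fun _ _ f hf ↦ ⟨(hL.cofibrations_iff f).2 hf.1, (hL.weakEquivalences_iff f).2
    (@isLocalEquivalence_of_weakEquivalence _ _ _ _ _ _ str _ _ hM.pushoutProduct S _ _ f
      ((@weakEquivalence_iff _ _ _ _ f str.categoryWithWeakEquivalences).2 hf.2))⟩

lemma fibration (hM : IsModelVCategory V str) {A B : M} (f : A ⟶ B)
    (hf : @Fibration M _ _ _ f L.categoryWithFibrations) :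
    @Fibration M _ _ _ f str.categoryWithFibrations := by
  rw [@fibration_iff_rlp _ _ L] at hf
  rw [@fibration_iff_rlp _ _ str]
  exact fun _ _ i hi ↦ hf i (hL.trivialCofibrations_le hM i hi)

variable (hS : ∀ {A B : M} (s : A ⟶ B), S s →
  @Cofibration M _ _ _ s str.categoryWithCofibrations ∧
    @IsCofibrant M _ str.categoryWithCofibrations _ A)
include hS

lemma mem_trivialCofibrations {A B : M} (s : A ⟶ B) (hs : S s) :
    @trivialCofibrations M _ L.categoryWithCofibrations L.categoryWithWeakEquivalences _ _ s :=
  ⟨(hL.cofibrations_iff s).2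
    ((@cofibration_iff _ _ _ _ s str.categoryWithCofibrations).1 (hS s hs).1),
    (hL.weakEquivalences_iff s).2 fun _ hX ↦ hX.weakEquivalence s hs⟩

/-- Hom-objects do not depend on the model structure, so the pushout-product axiom of `L` applies to
`s`, a trivial cofibration there. -/
lemma weakEquivalence_hom_map {A B : M} (s : A ⟶ B) (hs : S s) (X : M)
    (hX : @IsFibrant M _ L.categoryWithFibrations _ X) :
    WeakEquivalence (((ClosedModule.hom (V := V)).map s.op).app X) :=
  have h := hL.mem_trivialCofibrations hS s hs
  @EnrichedBousfield.weakEquivalence_hom_map _ _ _ _ _ _ L _ _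
    hL.isModelVCategory.pushoutProduct _ _ s
    ((@cofibration_iff _ _ _ _ s L.categoryWithCofibrations).2 h.1)
    ((@weakEquivalence_iff _ _ _ _ s L.categoryWithWeakEquivalences).2 h.2) X hX

lemma isLocal (hM : IsModelVCategory V str) (X : M)
    (hX : @IsFibrant M _ L.categoryWithFibrations _ X) : IsLocal V str S X :=
  @isLocal_of_weakEquivalence_hom_map V _ _ _ M _ _ _ str hM.pushoutProduct S hS X
    (hL.fibration hM _ hX) fun s hs ↦
    hL.weakEquivalence_hom_map hS s hs X hX

/-- A fibration from a local object to a fibrant object of the localization is a fibration of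
the localization. -/
lemma fibration_of_isLocal (hM : IsModelVCategory V str) {A B : M} (f : A ⟶ B)
    (hf : @Fibration M _ _ _ f str.categoryWithFibrations) (hA : IsLocal V str S A)
    (hB : @IsFibrant M _ L.categoryWithFibrations _ B) :
    @Fibration M _ _ _ f L.categoryWithFibrations := by
  have fac := @MorphismProperty.factorizationData _ _
    (@trivialCofibrations M _ L.categoryWithCofibrations L.categoryWithWeakEquivalences)
    (@fibrations M _ L.categoryWithFibrations) inferInstance _ _ f
  have hZ : IsLocal V str S fac.Z := hL.isLocal hS hM _
    (@isFibrant_of_fibration M _ L.categoryWithFibrations _ _ _ _ fac.p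
      ((@fibration_iff _ _ _ _ fac.p L.categoryWithFibrations).2 fac.hp) hB)
  have hi : @WeakEquivalence M _ _ _ fac.i str.categoryWithWeakEquivalences :=
    @weakEquivalence_of_isLocalEquivalence V _ _ _ M _ _ _ str hM S _ _ hA hZ fac.i
      ((hL.weakEquivalences_iff _).1 fac.hi.2)
  have hi' : @Cofibration M _ _ _ fac.i str.categoryWithCofibrations :=
    (@cofibration_iff _ _ _ _ _ str.categoryWithCofibrations).2 ((hL.cofibrations_iff _).1 fac.hi.1)
  have lift : HasLiftingProperty fac.i f := @ModelCategory.cm4a M _ str _ _ _ _ fac.i f hi' hi hf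
  refine (@fibration_iff _ _ _ _ _ L.categoryWithFibrations).2 ?_
  exact L.cm3b.of_retract (RetractArrow.ofRightLiftingProperty fac.fac) fac.hp

/-- If `f : A ⟶ B` has the right lifting property with respect to `I □ S`, with `I` generating
cofibrations and `B` fibrant in the localization, then precomposition with the morphisms
in `S` is a weak equivalence on hom-objects to `A`. -/
lemma weakEquivalence_hom_map_of_rlp {I : MorphismProperty V} (hI : IsGeneratingCofibrations I)
    {A B : M} (f : A ⟶ B) (hf : (pushoutProducts I S).rlp f)
    (hB : @IsFibrant M _ L.categoryWithFibrations _ B) {X Y : M} (s : X ⟶ Y) (hs : S s) :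
    WeakEquivalence (((ClosedModule.hom (V := V)).map s.op).app A) := by
  let sq := Functor.PullbackObjObj.ofHasPullback (ClosedModule.hom (V := V)) s f
  have hπ : trivialFibrations V sq.π := by
    rw [← hI]
    intro T T' k hk
    rw [hasLiftingProperty_pullbackObjObj_iff]
    exact hf _ (.mk k s hk hs)
  have hsB : trivialFibrations V (((ClosedModule.hom (V := V)).map s.op).app B) := by
    have h := hL.mem_trivialCofibrations hS s hs
    exact ⟨(@fibration_hom_map _ _ _ _ _ _ L _ _ hL.isModelVCategory.pushoutProduct _ _ s
      ((@cofibration_iff _ _ _ _ s L.categoryWithCofibrations).2 h.1) B hB).mem,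
      (hL.weakEquivalence_hom_map hS s hs B hB).mem⟩
  -- `sq.fst` is the base change of `s^*` on `B`; preceded by `sq.π` it is `s^*` on `A`.
  have hfst : trivialFibrations V sq.fst := MorphismProperty.of_isPullback sq.isPullback.flip hsB
  rw [weakEquivalence_iff, ← sq.π_fst]
  exact ((trivialFibrations V).comp_mem _ _ hπ hfst).2

end IsEnrichedBousfieldLocalization

end

end EnrichedBousfield

theorem mainTheorem2
    {V : Type u₁} [Category.{v₁} V] [ModelCategory V] [MonoidalCategory V]
    [EnrichedBousfield.MonoidalModelCategory V]
    (I : MorphismProperty V) (hI : EnrichedBousfield.IsGeneratingCofibrations I)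
    {M : Type u₂} [Category.{v₂} M] [MonoidalLeftAction V M]
    [EnrichedBousfield.ClosedModule V M]
    (str : ModelCategory M) (hM : EnrichedBousfield.IsModelVCategory V str)
    (J' : MorphismProperty M) (hJ' : EnrichedBousfield.IsWeaklyGenerating str J')
    (S : MorphismProperty M)
    (hS : ∀ {A B : M} (s : A ⟶ B), S s → Cofibration s ∧ IsCofibrant A)
    (L : ModelCategory M)
    (hL : EnrichedBousfield.IsEnrichedBousfieldLocalization V str S L) :
    EnrichedBousfield.IsWeaklyGenerating L
      (J' ⊔ EnrichedBousfield.pushoutProducts I S) where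
  le_trivialCofibrations := by
    refine sup_le (hJ'.le_trivialCofibrations.trans (hL.trivialCofibrations_le hM)) ?_
    rintro _ _ _ ⟨i, s, hi, hs⟩
    have h := hL.mem_trivialCofibrations hS s hs
    have hi' : Cofibration i := ⟨hI.le_cofibrations i hi⟩
    obtain ⟨hs, hs'⟩ := (mem_trivialCofibrations_iff s).1 h
    exact ⟨(hL.isModelVCategory.pushoutProduct.cofibration i s hi' hs).mem,
      (hL.isModelVCategory.pushoutProduct.weakEquivalence_right i s hi' hs hs').mem⟩
  fibration {A B} f hf hB := by
    have hB' := hL.fibration hM _ hB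
    have hf' := hJ'.fibration f (fun _ _ i hi ↦ hf i (Or.inl hi)) hB'
    refine hL.fibration_of_isLocal hS hM f hf' ?_ hB
    exact @EnrichedBousfield.isLocal_of_weakEquivalence_hom_map V _ _ _ M _ _ _ str
      hM.pushoutProduct S hS A
      (@EnrichedBousfield.isFibrant_of_fibration_of_isFibrant _ _ str _ _ f hf' hB') fun s hs ↦
        hL.weakEquivalence_hom_map_of_rlp hS hI f (fun _ _ i hi ↦ hf i (Or.inr hi)) hB s hs
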